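/- Let $K$ be an algebraically closed field of characteristic $\neq 2$ and let $m,n\ge 1$. Put $|i|=0$ for $1\le i\le m$ and $|i|=1$ for $m+1\le i\le m+n$. Let $A(m|n)$ be the superalgebra generated by $c_{ij}$, $1\le i,j\le m+n$, of parity $|c_{ij}|=|i|+|j| \bmod 2$, subject to $c_{ij}c_{kl}=(-1)^{|c_{ij}||c_{kl}|}c_{kl}c_{ij}$. Write $C=(c_{ij})=\begin{pmatrix}C_{11}&C_{12}\\C_{21}&C_{22}\end{pmatrix}$ with $C_{11}$ of size $m\times m$, put $D=\det C_{11}$, and let $K[G]$, $G=GL(m|n)$, be the localization of $A(m|n)$ at $D\det C_{22}$. For $1\le i,j\le m+n$ let $x\mapsto (x)_{ij}D$ be the right superderivation of $K[G]$ of parity $|i|+|j|$, that is, the $K$-linear map with $(ab)_{ij}D=(-1)^{(|i|+|j|)|b|}(a)_{ij}D\,b+a\,(b)_{ij}D$ for $b$ homogeneous and $(c_{kl})_{ij}D=\delta_{li}c_{kj}$. Let $y_{ij}$ ($1\le i\le m<j\le m+n$) be the entries of $C_{11}^{-1}C_{12}$ and $\phi(c_{ij})$ ($m+1\le i,j\le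 m+n$) the entries of $C_{22}-C_{21}C_{11}^{-1}C_{12}$. Put $D^+(i_1,\dots,i_s)=\det(c_{a,i_b})_{1\le a,b\le s}$ for $1\le i_1,\dots,i_s\le m$, and $D^-(j_1,\dots,j_s)=\det(\phi(c_{m+a,j_b}))_{1\le a,b\le s}$ for $m+1\le j_1,\dots,j_s\le m+n$. For a tableau $T(I)$ with entries $i_{ab}\in\{1,\dots,m\}$ (row $a$, column $b$, at most $m$ rows) whose $b$-th column has length $\ell(b)$, let $B^+(I)=\prod_b D^+(i_{1b},\dots,i_{\ell(b),b})$; define $B^-(J)$ in the same way from $D^-$ for a tableau $T(J)$ with entries in $\{m+1,\dots,m+n\}$ (at most $n$ rows). Let $\lambda=(\lambda^+|\lambda^-)$ with integers $\lambda^+_1\ge\dots\ge\lambda^+_m$ and $\lambda^-_1\ge\dots\ge\lambda^-_n\ge 0$. Let $w=w^+w^-$, where $w^-=B^-(J)$ for an arbitrary tableau $T(J)$ of shape $\lambda^-$, and $w^+=B^+(I)$ for an arbitrary tableau $T(I)$ of shape $\lambda^+$ if $\lambda^+_m\ge 0$, whereas $w^+=D^{\lambda^+_m}B^+(I)$ with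 $T(I)$ of shape $\lambda^+-\lambda^+_m(1,\dots,1)$ if $\lambda^+_m<0$. Then for all $1\le k\le m$ and $m+1\le l\le m+n$ $$(w)_{kl}D=\sum_{a=1}^m (w)_{ka}D\,y_{al}+\sum_{b=m+1}^{m+n}(w)_{bl}D\,y_{kb}\qquad\text{and}\qquad (w)_{lk}D=0.$$ In particular, if $v$ is the element $w$ for which all entries in the $a$-th row of $T(I)$ equal $a$ and all entries in the $a$-th row of $T(J)$ equal $m+a$ (the highest vector), then $$(v)_{kl}D=(\lambda^+_k+\lambda^-_{l-m})\,v\,y_{kl}+\sum_{k<s\le m}(v)_{ks}D\,y_{sl}+\sum_{m+1\le t<l}(v)_{tl}D\,y_{kt}\qquad\text{and}\qquad (v)_{lk}D=0.$$ -/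

import Mathlib

noncomputable section

namespace SuperGL

/-! Indices `1, …, m` (even) are `Sum.inl`, indices `m+1, …, m+n` (odd) are `Sum.inr`. -/

/-- The index set `{1, …, m+n}`, split into even indices (`inl`) and odd indices (`inr`). -/
abbrev Idx (m n : ℕ) : Type := Fin m ⊕ Fin n

/-- The parity `|i|` of an index. -/
def par {m n : ℕ} : Idx m n → ℕ := Sum.elim (fun _ => 0) (fun _ => 1)

/-- The parity `|c_{ij}| = |i| + |j|` of a generator (only its class modulo 2 matters). -/
def cpar {m n : ℕ} (i j : Idx m n) : ℕ := par i + par j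

section

variable (K : Type*) [Field K] (m n : ℕ)

/-- The supercommutativity relations `c_{ij} c_{kl} = (-1)^{|c_{ij}||c_{kl}|} c_{kl} c_{ij}`. -/
inductive Rel : FreeAlgebra K (Idx m n × Idx m n) → FreeAlgebra K (Idx m n × Idx m n) → Prop
  | comm (i j k l : Idx m n) :
      Rel (FreeAlgebra.ι K (i, j) * FreeAlgebra.ι K (k, l))
        ((-1) ^ (cpar i j * cpar k l) * (FreeAlgebra.ι K (k, l) * FreeAlgebra.ι K (i, j)))

/-- The commutative superalgebra `A(m|n)`, freely generated by the `c_{ij}` subject to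
supercommutativity. -/
def A : Type _ := RingQuot (Rel K m n)

instance : Ring (A K m n) := inferInstanceAs (Ring (RingQuot (Rel K m n)))

instance : Algebra K (A K m n) := inferInstanceAs (Algebra K (RingQuot (Rel K m n)))

/-- The quotient map from the free algebra. -/
def mkA : FreeAlgebra K (Idx m n × Idx m n) →ₐ[K] A K m n := RingQuot.mkAlgHom K (Rel K m n)

theorem mkA_surjective : Function.Surjective (mkA K m n) :=
  RingQuot.mkAlgHom_surjective K (Rel K m n)

variable {m n}

/-- The generator `c_{ij}` of `A(m|n)`. -/
def cA (i j : Idx m n) : A K m n := mkA K m n (FreeAlgebra.ι K (i, j))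

variable {K}

theorem cA_comm (i j k l : Idx m n) :
    cA K i j * cA K k l = (-1) ^ (cpar i j * cpar k l) * (cA K k l * cA K i j) := by
  have h : mkA K m n _ = mkA K m n _ := RingQuot.mkAlgHom_rel K (Rel.comm (K := K) i j k l)
  simpa [cA] using h

theorem A_induction {P : A K m n → Prop} (hK : ∀ r : K, P (algebraMap K _ r))
    (hc : ∀ i j, P (cA K i j)) (hmul : ∀ a b, P a → P b → P (a * b))
    (hadd : ∀ a b, P a → P b → P (a + b)) (a : A K m n) : P a := by
  obtain ⟨x, rfl⟩ := mkA_surjective K m n a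
  induction x using FreeAlgebra.induction with
  | grade0 r => simpa using hK r
  | grade1 x => exact hc x.1 x.2
  | mul a b ha hb => simpa using hmul _ _ ha hb
  | add a b ha hb => simpa using hadd _ _ ha hb

/-- The universal property of `A(m|n)`. -/
def liftA {B : Type*} [Ring B] [Algebra K B] (f : Idx m n → Idx m n → B)
    (hf : ∀ i j k l, f i j * f k l = (-1) ^ (cpar i j * cpar k l) * (f k l * f i j)) :
    A K m n →ₐ[K] B :=
  RingQuot.liftAlgHom K ⟨FreeAlgebra.lift K fun x => f x.1 x.2, by
    rintro _ _ ⟨i, j, k, l⟩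
    simpa using hf i j k l⟩

theorem liftA_cA {B : Type*} [Ring B] [Algebra K B] (f : Idx m n → Idx m n → B)
    (hf : ∀ i j k l, f i j * f k l = (-1) ^ (cpar i j * cpar k l) * (f k l * f i j))
    (i j : Idx m n) : liftA (K := K) f hf (cA K i j) = f i j := by
  refine (RingQuot.liftAlgHom_mkAlgHom_apply K _ _ _).trans ?_
  simp

theorem cA_mem_center {i j : Idx m n} (h : Even (cpar i j)) :
    cA K i j ∈ Subalgebra.center K (A K m n) := by
  rw [Subalgebra.mem_center_iff]
  intro b
  induction b using A_induction with
  | hK r => exact Algebra.commutes r _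
  | hc k l => rw [cA_comm, (h.mul_left (cpar k l)).neg_one_pow, one_mul]
  | hmul a b ha hb => rw [mul_assoc, hb, ← mul_assoc, ha, mul_assoc]
  | hadd a b ha hb => rw [add_mul, mul_add, ha, hb]

theorem even_inl (i j : Fin m) : Even (cpar (Sum.inl i : Idx m n) (Sum.inl j)) := by
  simp [cpar, par]

theorem even_inr (i j : Fin n) : Even (cpar (Sum.inr i : Idx m n) (Sum.inr j)) := by
  simp [cpar, par]

variable (K m n)

/-- The block `C_{11}` of `A(m|n)`; its entries are central. -/
def C11A : Matrix (Fin m) (Fin m) (Subalgebra.center K (A K m n)) :=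
  Matrix.of fun i j => ⟨cA K (Sum.inl i) (Sum.inl j), cA_mem_center (even_inl i j)⟩

/-- The block `C_{22}` of `A(m|n)`; its entries are central. -/
def C22A : Matrix (Fin n) (Fin n) (Subalgebra.center K (A K m n)) :=
  Matrix.of fun i j => ⟨cA K (Sum.inr i) (Sum.inr j), cA_mem_center (even_inr i j)⟩

/-- The element `D D₂₂ = det C₁₁ · det C₂₂`. -/
def dd : Subalgebra.center K (A K m n) := (C11A K m n).det * (C22A K m n).det

/-- The multiplicative set of powers of `D D₂₂`. -/
def ddPowers : Submonoid (A K m n) := Submonoid.powers (dd K m n : A K m n)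

variable {K m n}

theorem dd_comm (s : ddPowers K m n) (a : A K m n) : a * s = s * a := by
  obtain ⟨s, k, rfl⟩ := s
  exact Subalgebra.mem_center_iff.1 (pow_mem (dd K m n).2 k) a

instance : OreLocalization.OreSet (ddPowers K m n) where
  ore_right_cancel r₁ r₂ s h := ⟨s, by rwa [← dd_comm, ← dd_comm]⟩
  oreNum r _ := r
  oreDenom _ s := s
  ore_eq r s := (dd_comm s r).symm

variable (K m n)

/-- The coordinate ring `K[GL(m|n)]`, the localization of `A(m|n)` at `D D₂₂`. -/
def KG : Type _ := OreLocalization (ddPowers K m n) (A K m n)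

instance : Ring (KG K m n) := inferInstanceAs (Ring (OreLocalization (ddPowers K m n) (A K m n)))

instance : Algebra K (KG K m n) :=
  inferInstanceAs (Algebra K (OreLocalization (ddPowers K m n) (A K m n)))

/-- The canonical map `A(m|n) → K[G]`. -/
def toKG : A K m n →ₐ[K] KG K m n :=
  { OreLocalization.numeratorRingHom (S := ddPowers K m n) (R := A K m n) with
    commutes' := fun _ => rfl }

variable {m n}

/-- The generator `c_{ij}` in `K[G]`. -/
def c (i j : Idx m n) : KG K m n := toKG K m n (cA K i j)

variable {K}

theorem isUnit_toKG (s : ddPowers K m n) : IsUnit (toKG K m n s) :=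
  OreLocalization.numerator_isUnit s

/-- The universal property of the localization `K[G]`. -/
def liftKG {B : Type*} [Ring B] [Algebra K B] (f : A K m n →ₐ[K] B)
    (hf : IsUnit (f (dd K m n : A K m n))) : KG K m n →ₐ[K] B :=
  { OreLocalization.universalHom (S := ddPowers K m n) (f : A K m n →+* B)
      (IsUnit.liftRight ((f : A K m n →* B).comp (ddPowers K m n).subtype) (by
        rintro ⟨_, k, rfl⟩
        simpa using hf.pow k)) (fun s => by
          rw [IsUnit.coe_liftRight]; rfl) with
    commutes' := fun r => by
      exact (OreLocalization.universalHom_commutes _ _ _).trans (f.commutes r) }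

theorem liftKG_toKG {B : Type*} [Ring B] [Algebra K B] (f : A K m n →ₐ[K] B)
    (hf : IsUnit (f (dd K m n : A K m n))) (a : A K m n) :
    liftKG f hf (toKG K m n a) = f a :=
  OreLocalization.universalHom_commutes _ _ _

theorem KG_frac (x : KG K m n) : ∃ (a : A K m n) (s : ddPowers K m n),
    toKG K m n s * x = toKG K m n a := by
  induction x using OreLocalization.ind with
  | _ a s => exact ⟨a, s, OreLocalization.mul_cancel⟩

/-- An element of `K[G]` that commutes with all generators is central. -/
theorem mem_center_of_comm {x : KG K m n} (h : ∀ i j, c K i j * x = x * c K i j) :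
    x ∈ Subalgebra.center K (KG K m n) := by
  have hA : ∀ a : A K m n, toKG K m n a * x = x * toKG K m n a := by
    intro a
    induction a using A_induction with
    | hK r => rw [AlgHom.commutes]; exact Algebra.commutes r x
    | hc k l => exact h k l
    | hmul a b ha hb => rw [map_mul, mul_assoc, hb, ← mul_assoc, ha, mul_assoc]
    | hadd a b ha hb => rw [map_add, add_mul, mul_add, ha, hb]
  rw [Subalgebra.mem_center_iff]
  intro y
  obtain ⟨a, s, hs⟩ := KG_frac y
  apply (isUnit_toKG s).mul_left_cancel
  rw [← mul_assoc, hs, hA, ← mul_assoc, hA, mul_assoc, hs]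

theorem c_comm (i j k l : Idx m n) :
    c K i j * c K k l = (-1) ^ (cpar i j * cpar k l) * (c K k l * c K i j) := by
  have h := congrArg (toKG K m n) (cA_comm (K := K) i j k l)
  simpa [c] using h

/-! ### Superderivations -/

theorem parity_cases (i : Idx m n) : par i = 0 ∨ par i = 1 := by
  cases i <;> simp [par]

theorem twA_rel (p : ℕ) (i j k l : Idx m n) :
    ((-1) ^ (p * cpar i j) * c K i j) * ((-1) ^ (p * cpar k l) * c K k l) =
      (-1) ^ (cpar i j * cpar k l) *
        (((-1) ^ (p * cpar k l) * c K k l) * ((-1) ^ (p * cpar i j) * c K i j)) := by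
  rcases neg_one_pow_eq_or (KG K m n) (p * cpar i j) with h₁ | h₁ <;>
  rcases neg_one_pow_eq_or (KG K m n) (p * cpar k l) with h₂ | h₂ <;>
  simp [h₁, h₂, c_comm i j k l]

/-- The map `A(m|n) → K[G]` given by `c_{kl} ↦ (-1)^{p |c_{kl}|} c_{kl}`. -/
def twA (p : ℕ) : A K m n →ₐ[K] KG K m n :=
  liftA (fun k l => (-1) ^ (p * cpar k l) * c K k l) (twA_rel p)

theorem twA_dd (p : ℕ) : twA p (dd K m n : A K m n) = toKG K m n (dd K m n : A K m n) := by
  let S : Subring (Subalgebra.center K (A K m n)) :=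
    ((twA (K := K) (m := m) (n := n) p : A K m n →+* KG K m n).eqLocus (toKG K m n)).comap
      ((Subalgebra.center K (A K m n)).val : _ →+* A K m n)
  suffices h : dd K m n ∈ S from h
  have hc : ∀ i j : Idx m n, Even (cpar i j) → twA p (cA K i j) = toKG K m n (cA K i j) := by
    intro i j h
    rw [twA, liftA_cA, (h.mul_left p).neg_one_pow, one_mul]
    rfl
  refine S.mul_mem ?_ ?_
  · rw [Matrix.det_apply]
    exact sum_mem fun σ _ => by
      rw [Units.smul_def]
      exact zsmul_mem (S.prod_mem fun i _ => hc _ _ (even_inl _ _)) _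
  · rw [Matrix.det_apply]
    exact sum_mem fun σ _ => by
      rw [Units.smul_def]
      exact zsmul_mem (S.prod_mem fun i _ => hc _ _ (even_inr _ _)) _

theorem isUnit_dd : IsUnit (toKG K m n (dd K m n : A K m n)) :=
  isUnit_toKG ⟨_, Submonoid.mem_powers _⟩

/-- The automorphism `b ↦ (-1)^{p |b|} b` (for `b` homogeneous) of `K[G]`. -/
def tw (p : ℕ) : KG K m n →ₐ[K] KG K m n :=
  liftKG (twA p) (by rw [twA_dd]; exact isUnit_dd)

/-- The matrix `(c_{kl}, (c_{kl})_{ij}D; 0, (-1)^{|_{ij}D| |c_{kl}|} c_{kl})`. -/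
def derivMat (i j k l : Idx m n) : Matrix (Fin 2) (Fin 2) (KG K m n) :=
  !![c K k l, if l = i then c K k j else 0; 0, (-1) ^ (cpar i j * cpar k l) * c K k l]

theorem derivMat_rel (i j k l r s : Idx m n) :
    derivMat (K := K) i j k l * derivMat i j r s =
      (-1) ^ (cpar k l * cpar r s) * (derivMat i j r s * derivMat i j k l) := by
  have e : ((-1) ^ (cpar k l * cpar r s) : Matrix (Fin 2) (Fin 2) (KG K m n)) =
      Matrix.diagonal fun _ => (-1) ^ (cpar k l * cpar r s) := by
    rcases Nat.even_or_odd (cpar k l * cpar r s) with h | h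
    · simp [h.neg_one_pow]
    · rw [h.neg_one_pow, h.neg_one_pow]
      ext a b
      by_cases hab : a = b <;> simp [hab]
  have h₁ := c_comm (K := K) k l r s
  have h₂ := c_comm (K := K) k l r j
  have h₃ := c_comm (K := K) r s k j
  have h₄ := twA_rel (K := K) (cpar i j) k l r s
  rw [e]
  ext a b
  rw [Matrix.diagonal_mul]
  fin_cases a <;> fin_cases b
  · simpa [derivMat, Matrix.mul_apply, Fin.sum_univ_two] using h₁
  · have k₀ : ((-1) ^ 4 : KG K m n) = 1 := Even.neg_one_pow ⟨2, rfl⟩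
    have k₁ : s = i → c K k l * c K r j = (-1) ^ (cpar k l * cpar r s) *
        (c K r j * ((-1) ^ (cpar i j * cpar k l) * c K k l)) := by
      rintro rfl
      rw [h₂]
      rcases parity_cases s with a | a <;> rcases parity_cases j with b | b <;>
        rcases parity_cases k with d | d <;> rcases parity_cases l with e' | e' <;>
        rcases parity_cases r with f | f <;> simp [cpar, a, b, d, e', f, k₀]
    have k₂ : l = i → c K k j * ((-1) ^ (cpar i j * cpar r s) * c K r s) =
        (-1) ^ (cpar k l * cpar r s) * (c K r s * c K k j) := by
      rintro rfl
      rw [h₃]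
      rcases parity_cases s with a | a <;> rcases parity_cases j with b | b <;>
        rcases parity_cases k with d | d <;> rcases parity_cases l with e' | e' <;>
        rcases parity_cases r with f | f <;> simp [cpar, a, b, d, e', f, k₀]
    have k : c K k l * (if s = i then c K r j else 0) +
        (if l = i then c K k j else 0) * ((-1) ^ (cpar i j * cpar r s) * c K r s) =
        (-1) ^ (cpar k l * cpar r s) * (c K r s * (if l = i then c K k j else 0) +
          (if s = i then c K r j else 0) * ((-1) ^ (cpar i j * cpar k l) * c K k l)) := by
      rw [mul_add, add_comm]
      congr 1
      · by_cases hl : l = i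
        · rw [if_pos hl, k₂ hl]
        · simp [if_neg hl]
      · by_cases hs : s = i
        · rw [if_pos hs, k₁ hs]
        · simp [if_neg hs]
    simpa [derivMat, Matrix.mul_apply, Fin.sum_univ_two] using k
  · simp [derivMat, Matrix.mul_apply, Fin.sum_univ_two]
  · simpa [derivMat, Matrix.mul_apply, Fin.sum_univ_two] using h₄

/-- The algebra map `a ↦ (a, (a)_{ij}D; 0, (-1)^{|_{ij}D| |a|} a)` on `A(m|n)`. -/
def derivMatA (i j : Idx m n) : A K m n →ₐ[K] Matrix (Fin 2) (Fin 2) (KG K m n) :=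
  liftA (derivMat i j) (derivMat_rel i j)

theorem derivMatA_apply (i j : Idx m n) (a : A K m n) :
    derivMatA i j a 0 0 = toKG K m n a ∧ derivMatA i j a 1 0 = 0 ∧
      derivMatA i j a 1 1 = twA (cpar i j) a := by
  induction a using A_induction with
  | hK r => simp [Matrix.algebraMap_matrix_apply]
  | hc k l => simp [derivMatA, liftA_cA, derivMat, twA, c]
  | hmul a b ha hb => simp [Matrix.mul_apply, Fin.sum_univ_two, ha, hb]
  | hadd a b ha hb => simp [ha, hb]

theorem isUnit_upper {R : Type*} [Ring R] {M : Matrix (Fin 2) (Fin 2) R} (h₀ : IsUnit (M 0 0))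
    (h₁ : IsUnit (M 1 1)) (h : M 1 0 = 0) : IsUnit M := by
  obtain ⟨u, hu⟩ := h₀
  obtain ⟨v, hv⟩ := h₁
  have hM : M = !![(u : R), M 0 1; 0, v] := by
    ext a b; fin_cases a <;> fin_cases b <;> simp [hu, hv, h]
  refine ⟨⟨M, !![(↑u⁻¹ : R), -(↑u⁻¹ * M 0 1 * ↑v⁻¹); 0, (↑v⁻¹ : R)], ?_, ?_⟩, rfl⟩
  · rw [hM, Matrix.one_fin_two]
    simp [mul_assoc]
  · rw [hM, Matrix.one_fin_two]
    simp [mul_assoc]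

theorem isUnit_derivMatA (i j : Idx m n) : IsUnit (derivMatA i j (dd K m n : A K m n)) := by
  obtain ⟨h₀, h, h₁⟩ := derivMatA_apply i j (dd K m n : A K m n)
  exact isUnit_upper (h₀ ▸ isUnit_dd) (by rw [h₁, twA_dd]; exact isUnit_dd) h

/-- The algebra map `x ↦ (x, (x)_{ij}D; 0, (-1)^{|_{ij}D| |x|} x)` on `K[G]`. -/
def derivMatKG (i j : Idx m n) : KG K m n →ₐ[K] Matrix (Fin 2) (Fin 2) (KG K m n) :=
  liftKG (derivMatA i j) (isUnit_derivMatA i j)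

/-- The right superderivation `_{ij}D` of `K[G]`; `sderiv i j x` is `(x)_{ij}D`. It is characterized
by `sderiv_c`, `sderiv_mul` and linearity. -/
def sderiv (i j : Idx m n) : KG K m n →ₗ[K] KG K m n where
  toFun x := derivMatKG i j x 0 1
  map_add' x y := by simp
  map_smul' r x := by simp

theorem sderiv_c (i j k l : Idx m n) :
    sderiv i j (c K k l) = if l = i then c K k j else 0 := by
  change derivMatKG i j (toKG K m n (cA K k l)) 0 1 = _
  rw [derivMatKG, liftKG_toKG, derivMatA, liftA_cA]
  rfl

theorem tw_c (p : ℕ) (k l : Idx m n) : tw p (c K k l) = (-1) ^ (p * cpar k l) * c K k l := by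
  rw [c, tw, liftKG_toKG, twA, liftA_cA, c]

theorem derivMatKG_apply (i j : Idx m n) (x : KG K m n) :
    derivMatKG i j x 0 0 = x ∧ derivMatKG i j x 1 0 = 0 ∧
      derivMatKG i j x 1 1 = tw (cpar i j) x := by
  obtain ⟨a, s, hs⟩ := KG_frac x
  have e := congrArg (derivMatKG i j) hs
  rw [map_mul, derivMatKG, liftKG_toKG, liftKG_toKG, ← derivMatKG] at e
  have e' := congrArg (tw (cpar i j)) hs
  rw [map_mul, tw, liftKG_toKG, liftKG_toKG, ← tw] at e'
  obtain ⟨a₁, a₂, a₃⟩ := derivMatA_apply (K := K) i j a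
  obtain ⟨s₁, s₂, s₃⟩ := derivMatA_apply (K := K) i j (s : A K m n)
  have u := isUnit_toKG (K := K) s
  have u' : IsUnit (twA (cpar i j) (s : A K m n)) := by
    have := u.map (tw (cpar i j))
    rwa [tw, liftKG_toKG] at this
  have q₁₀ := congrFun (congrFun e 1) 0
  rw [Matrix.mul_apply, Fin.sum_univ_two, s₂, s₃, zero_mul, zero_add, a₂] at q₁₀
  have z := u'.mul_right_eq_zero.1 q₁₀
  have q₀₀ := congrFun (congrFun e 0) 0
  rw [Matrix.mul_apply, Fin.sum_univ_two, s₁, z, mul_zero, add_zero, a₁, ← hs] at q₀₀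
  have q₁₁ := congrFun (congrFun e 1) 1
  rw [Matrix.mul_apply, Fin.sum_univ_two, s₂, s₃, zero_mul, zero_add, a₃, ← e'] at q₁₁
  exact ⟨u.mul_left_cancel q₀₀, z, u'.mul_left_cancel q₁₁⟩

/-- The superderivation rule `(ab)_{ij}D = (-1)^{|_{ij}D||b|} (a)_{ij}D b + a (b)_{ij}D`, the sign
being expressed by the automorphism `tw`. -/
theorem sderiv_mul (i j : Idx m n) (a b : KG K m n) :
    sderiv i j (a * b) = sderiv i j a * tw (cpar i j) b + a * sderiv i j b := by
  change derivMatKG i j (a * b) 0 1 = derivMatKG i j a 0 1 * _ + _ * derivMatKG i j b 0 1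
  rw [map_mul, Matrix.mul_apply, Fin.sum_univ_two, (derivMatKG_apply i j a).1,
    (derivMatKG_apply i j b).2.2, add_comm]

/-! ### Determinants and bideterminants -/

theorem c_mem_center {i j : Idx m n} (h : Even (cpar i j)) :
    c K i j ∈ Subalgebra.center K (KG K m n) :=
  mem_center_of_comm fun k l => by rw [c_comm, (h.mul_left (cpar k l)).neg_one_pow, one_mul]

variable (K m n)

/-- The block `C_{11}`; its entries are even, hence central, so that the usual determinant
and inverse are available over the (commutative) center of `K[G]`. -/
def C11 : Matrix (Fin m) (Fin m) (Subalgebra.center K (KG K m n)) :=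
  Matrix.of fun i j => ⟨c K (Sum.inl i) (Sum.inl j), c_mem_center (even_inl i j)⟩

theorem toKG_mem_center (z : Subalgebra.center K (A K m n)) :
    toKG K m n z ∈ Subalgebra.center K (KG K m n) :=
  mem_center_of_comm fun i j => by
    rw [c, ← map_mul, ← map_mul, Subalgebra.mem_center_iff.1 z.2]

theorem isUnit_det_C11 : IsUnit (C11 K m n).det := by
  let f : Subalgebra.center K (A K m n) →ₐ[K] Subalgebra.center K (KG K m n) :=
    ((toKG K m n).comp (Subalgebra.center K (A K m n)).val).codRestrict _ (toKG_mem_center K m n)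
  have hf : (C11 K m n).det = f (C11A K m n).det := by
    rw [AlgHom.map_det]; rfl
  suffices h : IsUnit (f (dd K m n)) by
    rw [dd, map_mul] at h
    rw [hf]
    exact isUnit_of_mul_isUnit_left h
  obtain ⟨u, hu⟩ := isUnit_dd (K := K) (m := m) (n := n)
  have hu' : (u : KG K m n) ∈ Subalgebra.center K (KG K m n) := hu ▸ toKG_mem_center K m n _
  have hi : (↑u⁻¹ : KG K m n) ∈ Subalgebra.center K (KG K m n) := by
    rw [Subalgebra.mem_center_iff] at hu' ⊢
    intro b
    rw [Units.mul_inv_eq_iff_eq_mul, mul_assoc, hu' b, Units.inv_mul_cancel_left]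
  refine IsUnit.of_mul_eq_one ⟨_, hi⟩ (Subtype.ext ?_)
  change toKG K m n (dd K m n : A K m n) * ↑u⁻¹ = 1
  rw [← hu, Units.mul_inv]

/-- The unit `D = det C_{11}`. -/
def detUnit : (Subalgebra.center K (KG K m n))ˣ := (isUnit_det_C11 K m n).unit

variable {m n}

/-- `y_{ij} = φ(c_{ij})` for `i ≤ m < j`: the entries of `C_{11}^{-1} C_{12}`. -/
def y (i : Fin m) (j : Fin n) : KG K m n :=
  ∑ r, ((C11 K m n)⁻¹ i r : KG K m n) * c K (Sum.inl r) (Sum.inr j)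

/-- `φ(c_{ij})` for `i, j > m`: the entries of `C_{22} - C_{21} C_{11}^{-1} C_{12}`. -/
def phi (i j : Fin n) : KG K m n :=
  c K (Sum.inr i) (Sum.inr j) - ∑ r : Fin m, c K (Sum.inr i) (Sum.inl r) * y K r j

theorem phi_mem_center (i j : Fin n) : phi (m := m) K i j ∈ Subalgebra.center K (KG K m n) := by
  refine sub_mem (c_mem_center (even_inr i j)) (sum_mem fun r _ => ?_)
  rw [y, Finset.mul_sum]
  refine sum_mem fun s _ => ?_
  have hz := Subalgebra.mem_center_iff.1 ((C11 K m n)⁻¹ r s).2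
  rw [← mul_assoc, hz, mul_assoc]
  refine mul_mem ((C11 K m n)⁻¹ r s).2 (mem_center_of_comm fun k l => ?_)
  have h₁ := c_comm (K := K) k l (Sum.inr i) (Sum.inl r)
  have h₂ := c_comm (K := K) k l (Sum.inl s) (Sum.inr j)
  rw [show cpar (Sum.inr i : Idx m n) (Sum.inl r) = 1 from rfl, mul_one] at h₁
  rw [show cpar (Sum.inl s : Idx m n) (Sum.inr j) = 1 from rfl, mul_one] at h₂
  rw [← mul_assoc, h₁, mul_assoc, mul_assoc, h₂]
  rcases Nat.even_or_odd (cpar k l) with h | h <;> simp [h.neg_one_pow, mul_assoc]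

/-- `D⁺(i₁, …, i_s)`: the determinant with rows `1, …, s` and columns `i₁, …, i_s` of `C_{11}`. -/
def Dplus (n : ℕ) {s : ℕ} (hs : s ≤ m) (i : Fin s → Fin m) : Subalgebra.center K (KG K m n) :=
  ((C11 K m n).submatrix (Fin.castLE hs) i).det

/-- `D⁻(j₁, …, j_s)`: the determinant with entries `φ(c_{m+a, j_b})`, `1 ≤ a, b ≤ s`. -/
def Dminus (m : ℕ) {s : ℕ} (hs : s ≤ n) (j : Fin s → Fin n) : Subalgebra.center K (KG K m n) :=
  (Matrix.of fun a b : Fin s =>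
    (⟨phi K (Fin.castLE hs a) (j b), phi_mem_center K _ _⟩ :
      Subalgebra.center K (KG K m n))).det

end

/-- The length of the `b`-th column (`b = 0, 1, …`) of the diagram with row lengths `μ`. -/
def colLen {r : ℕ} (μ : Fin r → ℕ) (b : ℕ) : ℕ := (Finset.univ.filter fun a => b < μ a).card

theorem colLen_le {r : ℕ} (μ : Fin r → ℕ) (b : ℕ) : colLen μ b ≤ r :=
  (Finset.card_le_univ _).trans_eq (Fintype.card_fin r)

section

variable (K : Type*) [Field K] {m n : ℕ}

/-- The bideterminant `B⁺(I) = ∏_b D⁺(i_{1b}, …, i_{ℓ(b), b})` of a tableau of shape `μ`. The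
tableau is given by its entries `T a b` in row `a` and column `b` (rows and columns are numbered
from zero; values outside of the diagram are not used). -/
def Bplus (n : ℕ) (μ : Fin m → ℕ) (T : Fin m → ℕ → Fin m) : Subalgebra.center K (KG K m n) :=
  ∏ b ∈ Finset.range (Finset.univ.sup μ),
    Dplus K n (colLen_le μ b) fun a => T (Fin.castLE (colLen_le μ b) a) b

/-- The bideterminant `B⁻(J) = ∏_b D⁻(j_{1b}, …, j_{ℓ(b), b})` of a tableau of shape `μ`. -/
def Bminus (m : ℕ) (μ : Fin n → ℕ) (T : Fin n → ℕ → Fin n) : Subalgebra.center K (KG K m n) :=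
  ∏ b ∈ Finset.range (Finset.univ.sup μ),
    Dminus K m (colLen_le μ b) fun a => T (Fin.castLE (colLen_le μ b) a) b

/-- `min(λ⁺_m, 0)`: the exponent of `D` to be split off (it is zero iff `λ⁺` is polynomial). -/
def twist (lp : Fin m → ℤ) : ℤ := if h : 0 < m then min (lp ⟨m - 1, by omega⟩) 0 else 0

/-- The shape `λ⁺ - min(λ⁺_m, 0) (1, …, 1)`, which is `λ⁺` when `λ⁺` is polynomial. -/
def shape (lp : Fin m → ℤ) (a : Fin m) : ℕ := (lp a - twist lp).toNat

/-- The element `w⁺` of shape `λ⁺`: the bideterminant `B⁺(I)` when `λ⁺` is polynomial, and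
`D^{λ⁺_m} B⁺(I)`, with `I` of shape `λ⁺ - λ⁺_m (1, …, 1)`, when `λ⁺_m < 0`. -/
def wplus (n : ℕ) (lp : Fin m → ℤ) (I : Fin m → ℕ → Fin m) : Subalgebra.center K (KG K m n) :=
  ((detUnit K m n ^ twist lp : (Subalgebra.center K (KG K m n))ˣ) :
    Subalgebra.center K (KG K m n)) * Bplus K n (shape lp) I

/-- The generator `w = w⁺ w⁻` of `H⁰_{G_ev}(λ)`, embedded in `K[G]`. -/
def w (lp : Fin m → ℤ) (lm : Fin n → ℕ) (I : Fin m → ℕ → Fin m) (J : Fin n → ℕ → Fin n) :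
    KG K m n :=
  (wplus K n lp I * Bminus K m lm J : Subalgebra.center K (KG K m n))

/-- The highest vector `v = v⁺ v⁻`, given by the tableaux `T_λ⁺` and `T_λ⁻`: all entries in the `a`-th row of either tableau are the
`a`-th index. -/
def v (lp : Fin m → ℤ) (lm : Fin n → ℕ) : KG K m n :=
  w K lp lm (fun a _ => a) (fun a _ => a)

end

end SuperGL

end

/-! Restricted to central elements fixed by the parity automorphisms `tw p`, a right superderivation
is an ordinary derivation: its sign disappears. Right multiplication by any `y` is linear over these
elements, so the difference Δ of the two sides of the formula for `_{kl}D` (`defect`) is also a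
derivation there. It therefore suffices that Δ and `_{lk}D` vanish on the entries of `C₁₁` and on
the `φ(c_{ij})`: determinants, products and inverses of elements killed by a derivation are again
killed, and `w` is built from these for every choice of tableaux (`hasWeight_zero_w`).

On these generators everything follows from `C₁₁ Y = C₁₂`, with `Y = (y_{ij})`. Differentiating this
relation and cancelling `C₁₁` gives the derivatives of `y`, hence those of `φ`: `(φ_{ij})_{kl}D =
φ_{il} y_{kj}`, `(φ_{ij})_{bl}D = δ_{jb} φ_{il}`, and zero for `_{ka}D` and `_{lk}D`.

For `v` all determinants are leading minors. For `a ≤ k`, `_{ka}D` replaces column `k` of `C₁₁` by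
column `a`. If `a < k`, two columns agree and the minor is killed; if `a = k`, a minor containing
column `k` is reproduced. Summing these integral weights over the columns of the tableau gives
`λ⁺_k`; the odd block is similar. The diagonal terms yield the coefficient of `v y_{kl}`, and one
triangular half of each sum drops out (`hasWeight_leading_minor`, `sderiv_ll_v`, `sderiv_rr_v`). -/

section Determinants

variable {K R S M ι : Type*} [CommRing K] [CommRing R] [CommRing S] [Algebra K R] [Algebra R S]
  [AddCommGroup M] [Module K M] [Module R M]

theorem Derivation.leibniz_finset_prod [DecidableEq ι] (d : Derivation K R M) (s : Finset ι)
    (f : ι → R) : d (∏ i ∈ s, f i) = ∑ i ∈ s, (∏ j ∈ s.erase i, f j) • d (f i) := by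
  induction s using Finset.induction_on with
  | empty => simp
  | insert a s ha ih =>
    rw [Finset.prod_insert ha, Derivation.leibniz, ih, Finset.sum_insert ha,
      Finset.erase_insert ha, add_comm, Finset.smul_sum]
    congr 1
    refine Finset.sum_congr rfl fun i hi => ?_
    rw [Finset.erase_insert_of_ne (by rintro rfl; exact ha hi),
      Finset.prod_insert (fun h => ha (Finset.mem_of_mem_erase h)), smul_smul]

/-- The derivative of a determinant is the sum over the columns of the determinants in which that
column is differentiated. -/
theorem Derivation.map_det [Fintype ι] [DecidableEq ι] (d : Derivation K R M) (f : S →ₗ[R] M)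
    (A : Matrix ι ι R) (B : Matrix ι ι S) (h : ∀ i j, d (A i j) = f (B i j)) :
    d A.det = f (∑ j, ((A.map (algebraMap R S)).updateCol j fun i => B i j).det) := by
  simp only [Matrix.det_apply]
  rw [Finset.sum_comm, _root_.map_sum, _root_.map_sum]
  refine Finset.sum_congr rfl fun σ _ => ?_
  rw [← Finset.smul_sum, Units.smul_def, Units.smul_def, map_zsmul, map_zsmul,
    d.leibniz_finset_prod, _root_.map_sum]
  congr 1
  refine Finset.sum_congr rfl fun j _ => ?_
  rw [h, ← f.map_smul, ← Finset.mul_prod_erase _ _ (Finset.mem_univ j), Algebra.smul_def,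
    map_prod, mul_comm, Matrix.updateCol_self]
  congr 2
  refine Finset.prod_congr rfl fun i hi => ?_
  rw [Matrix.updateCol_ne (Finset.ne_of_mem_erase hi), Matrix.map_apply]

end Determinants

/-! ### Row lengths and column lengths of the diagrams. -/

/-- Rows are numbered from zero, so `k < colLen μ b` says that column `b` meets row `k`; for weakly
decreasing rows this means `b < μ k`. -/
theorem SuperGL.sum_range_lt_colLen {r : ℕ} (μ : Fin r → ℕ) (hμ : Antitone μ) (k : Fin r) :
    ∑ b ∈ Finset.range (Finset.univ.sup μ), (if (k : ℕ) < colLen μ b then 1 else 0 : ℤ) = μ k := by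
  have h : ∀ b, (k : ℕ) < colLen μ b ↔ b < μ k := by
    intro b
    constructor
    · intro hk
      by_contra hb
      -- If row `k` misses column `b`, so do all later rows, which leaves at most the `k` rows
      -- before it.
      have hs : (Finset.univ.filter fun a => b < μ a) ⊆ Finset.Iio k := by
        intro a ha
        rw [Finset.mem_filter] at ha
        rw [Finset.mem_Iio]
        by_contra hak
        exact hb (ha.2.trans_le (hμ (not_lt.1 hak)))
      have := Finset.card_le_card hs
      rw [Fin.card_Iio] at this
      exact absurd hk (not_lt.2 this)
    · intro hb
      have hs : Finset.Iic k ⊆ (Finset.univ.filter fun a => b < μ a) := by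
        intro a ha
        rw [Finset.mem_filter]
        exact ⟨Finset.mem_univ _, hb.trans_le (hμ (Finset.mem_Iic.1 ha))⟩
      have := Finset.card_le_card hs
      rw [Fin.card_Iic] at this
      exact this
  simp only [h]
  rw [Finset.sum_boole]
  congr 1
  rw [show (Finset.range (Finset.univ.sup μ)).filter (fun b => b < μ k) = Finset.range (μ k) from ?_,
    Finset.card_range]
  ext b
  simp only [Finset.mem_filter, Finset.mem_range, and_iff_right_iff_imp]
  exact fun hb => hb.trans_le (Finset.le_sup (Finset.mem_univ k))

/-- The last entry of `lp` is its least, so `twist lp ≤ lp k` and `toNat` in `shape` truncates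
nothing. -/
theorem SuperGL.twist_add_shape {m : ℕ} (lp : Fin m → ℤ) (h : Antitone lp) (k : Fin m) :
    twist lp + (shape lp k : ℤ) = lp k := by
  have hk : twist lp ≤ lp k := by
    have hm : 0 < m := k.pos
    rw [twist, dif_pos hm]
    exact (min_le_left _ _).trans (h (Fin.le_def.2 (Nat.le_sub_one_of_lt k.2)))
  rw [shape, Int.toNat_of_nonneg (sub_nonneg.2 hk)]
  ring

theorem SuperGL.antitone_shape {m : ℕ} (lp : Fin m → ℤ) (h : Antitone lp) :
    Antitone (shape lp) := fun _ _ hab => Int.toNat_le_toNat (sub_le_sub_right (h hab) _)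

namespace SuperGL

variable {K : Type*} [Field K] {m n : ℕ}

/-! ### The parity automorphism and the entries of `C₁₁⁻¹ C₁₂` -/

theorem c_mul_inv_sum (i j : Fin m) :
    ∑ r, c (n := n) K (Sum.inl i) (Sum.inl r) * ((C11 K m n)⁻¹ r j : KG K m n) =
      if i = j then 1 else 0 := by
  have h := congrFun (congrFun (Matrix.mul_nonsing_inv _ (isUnit_det_C11 K m n)) i) j
  rw [Matrix.mul_apply] at h
  have h' := congrArg (Subalgebra.val _) h
  rw [map_sum, Matrix.one_apply] at h'
  simp only [map_mul, apply_ite (Subalgebra.val _), map_one, map_zero] at h'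
  exact h'

theorem inv_mul_c_sum (i j : Fin m) :
    ∑ r, ((C11 K m n)⁻¹ i r : KG K m n) * c (n := n) K (Sum.inl r) (Sum.inl j) =
      if i = j then 1 else 0 := by
  have h := congrFun (congrFun (Matrix.nonsing_inv_mul _ (isUnit_det_C11 K m n)) i) j
  rw [Matrix.mul_apply] at h
  have h' := congrArg (Subalgebra.val _) h
  rw [map_sum, Matrix.one_apply] at h'
  simp only [map_mul, apply_ite (Subalgebra.val _), map_one, map_zero] at h'
  exact h'

/-- This is `C₁₁ Y = C₁₂`, the only property of `y` needed to differentiate it. -/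
theorem sum_c_mul_y (i : Fin m) (j : Fin n) :
    ∑ r, c K (Sum.inl i) (Sum.inl r) * y K r j = c K (Sum.inl i) (Sum.inr j) := by
  simp only [y, Finset.mul_sum, ← mul_assoc]
  rw [Finset.sum_comm]
  simp only [← Finset.sum_mul, c_mul_inv_sum, ite_mul, one_mul, zero_mul]
  simp

/-- Left cancellation of the invertible `C₁₁`; it avoids differentiating the entries of the inverse
matrix. -/
theorem eq_of_sum_c_mul_eq {f g : Fin m → KG K m n}
    (h : ∀ i, ∑ r, c K (Sum.inl i) (Sum.inl r) * f r = ∑ r, c K (Sum.inl i) (Sum.inl r) * g r)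
    (r : Fin m) : f r = g r := by
  have key : ∀ f : Fin m → KG K m n, ∑ i, ((C11 K m n)⁻¹ r i : KG K m n) *
      ∑ s, c K (Sum.inl i) (Sum.inl s) * f s = f r := by
    intro f
    simp only [Finset.mul_sum, ← mul_assoc]
    rw [Finset.sum_comm]
    simp only [← Finset.sum_mul, inv_mul_c_sum, ite_mul, one_mul, zero_mul]
    simp
  rw [← key f, ← key g]
  simp only [h]

theorem neg_one_pow_comm (p : ℕ) (x : KG K m n) : x * (-1) ^ p = (-1) ^ p * x := by
  rcases neg_one_pow_eq_or (KG K m n) p with h | h <;> simp [h]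

theorem tw_c_ll (p : ℕ) (i j : Fin m) :
    tw p (c (n := n) K (Sum.inl i) (Sum.inl j)) = c K (Sum.inl i) (Sum.inl j) := by
  rw [tw_c, ((even_inl i j).mul_left p).neg_one_pow, one_mul]

theorem tw_c_rr (p : ℕ) (i j : Fin n) :
    tw p (c (m := m) K (Sum.inr i) (Sum.inr j)) = c K (Sum.inr i) (Sum.inr j) := by
  rw [tw_c, ((even_inr i j).mul_left p).neg_one_pow, one_mul]

/-- The `y_{ij}` are odd: in `C₁₁ Y = C₁₂` the automorphism fixes `C₁₁` and multiplies `C₁₂` by the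
sign. -/
theorem tw_y (p : ℕ) (i : Fin m) (j : Fin n) : tw p (y K i j) = (-1) ^ p * y K i j := by
  refine eq_of_sum_c_mul_eq (f := fun i => tw p (y K i j)) (g := fun i => (-1) ^ p * y K i j)
    (fun i => ?_) i
  have h := congrArg (tw p) (sum_c_mul_y (K := K) i j)
  simp only [map_sum, map_mul, tw_c_ll] at h
  rw [h, tw_c, ← sum_c_mul_y, Finset.mul_sum]
  refine Finset.sum_congr rfl fun r _ => ?_
  rw [← mul_assoc, ← mul_assoc, neg_one_pow_comm]
  simp [cpar, par]

theorem tw_phi (p : ℕ) (i j : Fin n) : tw p (phi (m := m) K i j) = phi K i j := by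
  rw [phi, map_sub, tw_c_rr, map_sum]
  congr 1
  refine Finset.sum_congr rfl fun r _ => ?_
  rw [map_mul, tw_y, tw_c, mul_assoc, ← mul_assoc (c K _ _), neg_one_pow_comm, mul_assoc,
    ← mul_assoc, ← pow_add]
  rw [Even.neg_one_pow (by simp [cpar, par]), one_mul]

/-! ### The superderivations on the entries -/

/-- The superderivation rule applied to `C₁₁ Y = C₁₂`; the sign is the parity of `y`. -/
theorem sum_c_mul_sderiv_y (u v : Idx m n) (i : Fin m) (j : Fin n) :
    ∑ r, c K (Sum.inl i) (Sum.inl r) * sderiv u v (y K r j) =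
      (if Sum.inr j = u then c K (Sum.inl i) v else 0) -
        ∑ r, (if Sum.inl r = u then c K (Sum.inl i) v else 0) * ((-1) ^ cpar u v * y K r j) := by
  have h := congrArg (sderiv u v) (sum_c_mul_y (K := K) i j)
  simp only [map_sum, sderiv_mul, sderiv_c, tw_y, Finset.sum_add_distrib] at h
  rw [← h]
  abel

theorem sderiv_y_ll (k a r : Fin m) (j : Fin n) :
    sderiv (Sum.inl k) (Sum.inl a) (y K r j) = if r = a then -y K k j else 0 := by
  refine eq_of_sum_c_mul_eq (f := fun r => sderiv (Sum.inl k) (Sum.inl a) (y K r j))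
    (g := fun r => if r = a then -y K k j else 0) (fun i => ?_) r
  rw [sum_c_mul_sderiv_y]
  simp [cpar, par, ite_mul, mul_ite]

theorem sderiv_y_rr (b l : Fin n) (r : Fin m) (j : Fin n) :
    sderiv (Sum.inr b) (Sum.inr l) (y K r j) = if j = b then y K r l else 0 := by
  refine eq_of_sum_c_mul_eq (f := fun r => sderiv (Sum.inr b) (Sum.inr l) (y K r j))
    (g := fun r => if j = b then y K r l else 0) (fun i => ?_) r
  rw [sum_c_mul_sderiv_y]
  by_cases h : j = b <;> simp [h, sum_c_mul_y]

theorem sderiv_y_lr (k : Fin m) (l : Fin n) (r : Fin m) (j : Fin n) :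
    sderiv (Sum.inl k) (Sum.inr l) (y K r j) = y K r l * y K k j := by
  refine eq_of_sum_c_mul_eq (f := fun r => sderiv (Sum.inl k) (Sum.inr l) (y K r j))
    (g := fun r => y K r l * y K k j) (fun i => ?_) r
  rw [sum_c_mul_sderiv_y]
  simp only [← mul_assoc, ← Finset.sum_mul, sum_c_mul_y]
  simp [cpar, par, ite_mul]

theorem sderiv_y_rl (k : Fin m) (l : Fin n) (r : Fin m) (j : Fin n) :
    sderiv (Sum.inr l) (Sum.inl k) (y K r j) = if j = l ∧ r = k then 1 else 0 := by
  refine eq_of_sum_c_mul_eq (f := fun r => sderiv (Sum.inr l) (Sum.inl k) (y K r j))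
    (g := fun r => if j = l ∧ r = k then 1 else 0) (fun i => ?_) r
  rw [sum_c_mul_sderiv_y]
  by_cases h : j = l <;> simp [h]

theorem sderiv_phi (u v : Idx m n) (i j : Fin n) :
    sderiv u v (phi K i j) = (if Sum.inr j = u then c K (Sum.inr i) v else 0) -
      ∑ r, ((if Sum.inl r = u then c K (Sum.inr i) v else 0) * ((-1) ^ cpar u v * y K r j) +
        c K (Sum.inr i) (Sum.inl r) * sderiv u v (y K r j)) := by
  rw [phi, map_sub, map_sum, sderiv_c]
  simp only [sderiv_mul, sderiv_c, tw_y]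

theorem sderiv_phi_ll (k a : Fin m) (i j : Fin n) :
    sderiv (Sum.inl k) (Sum.inl a) (phi K i j) = 0 := by
  rw [sderiv_phi]
  simp [sderiv_y_ll, Finset.sum_add_distrib, cpar, par, ite_mul, mul_ite]

theorem sderiv_phi_rr (b l : Fin n) (i j : Fin n) :
    sderiv (Sum.inr b) (Sum.inr l) (phi (m := m) K i j) = if j = b then phi K i l else 0 := by
  rw [sderiv_phi]
  by_cases h : j = b <;> simp [h, sderiv_y_rr, phi]

/-- The sign of the odd `y` turns the first correction into `+c_{il} y_{kj}`. Together with `-∑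
c_{ir} y_{rl} y_{kj}` it forms `φ_{il} y_{kj}`. -/
theorem sderiv_phi_lr (k : Fin m) (l : Fin n) (i j : Fin n) :
    sderiv (Sum.inl k) (Sum.inr l) (phi K i j) = phi K i l * y K k j := by
  rw [sderiv_phi]
  simp only [sderiv_y_lr, Finset.sum_add_distrib, phi, sub_mul, Finset.sum_mul, mul_assoc]
  simp [cpar, par, ite_mul]
  abel

/-- For `j = l` the term `c_{ik}` from `C₂₂` cancels against the one from `C₂₁ Y`. -/
theorem sderiv_phi_rl (k : Fin m) (l : Fin n) (i j : Fin n) :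
    sderiv (Sum.inr l) (Sum.inl k) (phi K i j) = 0 := by
  rw [sderiv_phi]
  by_cases h : j = l <;> simp [h, sderiv_y_rl]

end SuperGL

noncomputable section

namespace SuperGL

variable {K : Type*} [Field K] {m n : ℕ}

/-! ### The even central elements -/

variable (K m n) in
/-- The central elements of `K[G]` fixed by the parity automorphism. -/
def evenCenter : Subalgebra K (Subalgebra.center K (KG K m n)) :=
  ⨅ p : ℕ, AlgHom.equalizer ((tw p).comp (Subalgebra.val _)) (Subalgebra.val _)

theorem mem_evenCenter {z : Subalgebra.center K (KG K m n)} :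
    z ∈ evenCenter K m n ↔ ∀ p, tw p (z : KG K m n) = z := by
  simp [evenCenter, Algebra.mem_iInf, AlgHom.mem_equalizer]

variable (K m n) in
/-- The inclusion of the center, linear over the even central elements. -/
def centerVal : Subalgebra.center K (KG K m n) →ₗ[evenCenter K m n] KG K m n where
  toFun z := z
  map_add' _ _ := rfl
  map_smul' _ _ := rfl

/-- The restriction of a superderivation to the even central elements is a derivation. -/
def evenDeriv (i j : Idx m n) : Derivation K (evenCenter K m n) (KG K m n) :=
  Derivation.mk' ((sderiv i j).comp
    ((Subalgebra.val _).toLinearMap.comp (evenCenter K m n).val.toLinearMap)) (by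
    intro a b
    change sderiv i j ((a : KG K m n) * (b : KG K m n)) =
      (a : KG K m n) * sderiv i j b + (b : KG K m n) * sderiv i j a
    -- Invariance of `b` under `tw` removes the sign, and centrality of `b` moves it to the left.
    rw [sderiv_mul, mem_evenCenter.1 b.2, add_comm, Subalgebra.mem_center_iff.1 b.1.2])

variable (K m n) in
/-- Right multiplication, linear over the even central elements. -/
def mulRightEven (y : KG K m n) : KG K m n →ₗ[evenCenter K m n] KG K m n where
  toFun x := x * y
  map_add' a b := add_mul a b y
  map_smul' a b := mul_assoc (a : KG K m n) b y

/-- The defect in the formula for the odd superderivation `_{kl}D`. -/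
def defect (k : Fin m) (l : Fin n) : Derivation K (evenCenter K m n) (KG K m n) :=
  evenDeriv (Sum.inl k) (Sum.inr l) -
    (∑ a, (mulRightEven K m n (y K a l)).compDer (evenDeriv (Sum.inl k) (Sum.inl a)) +
      ∑ b, (mulRightEven K m n (y K k b)).compDer (evenDeriv (Sum.inr b) (Sum.inr l)))

theorem derivation_sum_apply {ι : Type*} (s : Finset ι)
    (d : ι → Derivation K (evenCenter K m n) (KG K m n)) (a : evenCenter K m n) :
    (∑ i ∈ s, d i) a = ∑ i ∈ s, d i a := by
  classical
  induction s using Finset.induction_on with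
  | empty => simp
  | insert i s hi ih => simp [Finset.sum_insert hi, ih]

theorem defect_apply (k : Fin m) (l : Fin n) (a : evenCenter K m n) :
    defect k l a = sderiv (Sum.inl k) (Sum.inr l) (a : KG K m n) -
      (∑ s, sderiv (Sum.inl k) (Sum.inl s) (a : KG K m n) * y K s l +
        ∑ b, sderiv (Sum.inr b) (Sum.inr l) (a : KG K m n) * y K k b) := by
  rw [defect, Derivation.sub_apply, Derivation.add_apply, derivation_sum_apply,
    derivation_sum_apply]
  rfl

/-! ### Weight vectors of derivations -/

/-- `z` is even central and an eigenvector of `d` of integral eigenvalue `r`. -/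
def HasWeight (d : Derivation K (evenCenter K m n) (KG K m n)) (r : ℤ)
    (z : Subalgebra.center K (KG K m n)) : Prop :=
  ∃ h : z ∈ evenCenter K m n, d ⟨z, h⟩ = r • (z : KG K m n)

variable {d : Derivation K (evenCenter K m n) (KG K m n)}

theorem HasWeight.one : HasWeight d 0 1 :=
  ⟨one_mem _, by rw [zero_smul]; exact d.map_one_eq_zero⟩

theorem HasWeight.mul {r s : ℤ} {a b : Subalgebra.center K (KG K m n)} (ha : HasWeight d r a)
    (hb : HasWeight d s b) : HasWeight d (r + s) (a * b) := by
  obtain ⟨ha, ha'⟩ := ha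
  obtain ⟨hb, hb'⟩ := hb
  refine ⟨mul_mem ha hb, ?_⟩
  change d ((⟨a, ha⟩ : evenCenter K m n) * ⟨b, hb⟩) = _
  rw [d.leibniz, ha', hb']
  change (a : KG K m n) * (s • (b : KG K m n)) + (b : KG K m n) * (r • (a : KG K m n)) =
    (r + s) • ((a : KG K m n) * b)
  rw [mul_smul_comm, mul_smul_comm, Subalgebra.mem_center_iff.1 a.2, add_smul, add_comm]

theorem HasWeight.prod {ι : Type*} (s : Finset ι) {r : ι → ℤ}
    {f : ι → Subalgebra.center K (KG K m n)} (h : ∀ i ∈ s, HasWeight d (r i) (f i)) :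
    HasWeight d (∑ i ∈ s, r i) (∏ i ∈ s, f i) := by
  classical
  induction s using Finset.induction_on with
  | empty => simpa using HasWeight.one
  | insert i s hi ih =>
    rw [Finset.sum_insert hi, Finset.prod_insert hi]
    exact (h i (Finset.mem_insert_self _ _)).mul
      (ih fun j hj => h j (Finset.mem_insert_of_mem hj))

theorem HasWeight.inv {r : ℤ} {u : (Subalgebra.center K (KG K m n))ˣ}
    (hu : HasWeight d r (u : Subalgebra.center K (KG K m n))) :
    HasWeight d (-r) ((u⁻¹ : (Subalgebra.center K (KG K m n))ˣ) :
      Subalgebra.center K (KG K m n)) := by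
  obtain ⟨hu, hu'⟩ := hu
  have e : ((u : Subalgebra.center K (KG K m n)) : KG K m n) *
      ((u⁻¹ : (Subalgebra.center K (KG K m n))ˣ) : Subalgebra.center K (KG K m n)) = 1 :=
    congrArg (Subalgebra.val _) u.mul_inv
  have e' : (((u⁻¹ : (Subalgebra.center K (KG K m n))ˣ) : Subalgebra.center K (KG K m n)) :
      KG K m n) * (u : Subalgebra.center K (KG K m n)) = 1 :=
    congrArg (Subalgebra.val _) u.inv_mul
  -- The inverse is only known to be central; uniqueness of inverses shows that `tw p` fixes it.
  have hi : ((u⁻¹ : (Subalgebra.center K (KG K m n))ˣ) : Subalgebra.center K (KG K m n)) ∈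
      evenCenter K m n := by
    rw [mem_evenCenter] at hu ⊢
    intro p
    have h := congrArg (tw p) e
    rw [map_mul, map_one, hu] at h
    exact (left_inv_eq_right_inv e' h).symm
  refine ⟨hi, ?_⟩
  have h : (⟨_, hi⟩ : evenCenter K m n) * ⟨_, hu⟩ = 1 := Subtype.ext u.inv_mul
  rw [d.leibniz_of_mul_eq_one h, hu', smul_comm, neg_smul, neg_smul, pow_two, smul_neg]
  congr 1
  change r • ((_ * _) * _) = _
  rw [mul_assoc]
  congr 1
  rw [e', mul_one]

theorem HasWeight.pow {r : ℤ} {a : Subalgebra.center K (KG K m n)} (ha : HasWeight d r a)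
    (k : ℕ) : HasWeight d (k * r) (a ^ k) := by
  simpa using HasWeight.prod (Finset.range k) (fun _ _ => ha)

theorem HasWeight.zpow {r : ℤ} {u : (Subalgebra.center K (KG K m n))ˣ}
    (hu : HasWeight d r (u : Subalgebra.center K (KG K m n))) (k : ℤ) :
    HasWeight d (k * r) ((u ^ k : (Subalgebra.center K (KG K m n))ˣ) :
      Subalgebra.center K (KG K m n)) := by
  cases k with
  | ofNat k => simpa using hu.pow k
  | negSucc k =>
    rw [zpow_negSucc, Int.negSucc_eq, neg_mul]
    exact HasWeight.inv (by simpa using hu.pow (k + 1))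

/-! ### Weights of minors -/

theorem coe_det_evenCenter {ι : Type*} [Fintype ι] [DecidableEq ι]
    {A : Matrix ι ι (Subalgebra.center K (KG K m n))} (hA : ∀ i j, A i j ∈ evenCenter K m n) :
    A.det = (Matrix.of fun i j => (⟨A i j, hA i j⟩ : evenCenter K m n)).det := by
  change _ = (evenCenter K m n).val _
  rw [AlgHom.map_det]
  rfl

/-- Derivatives lie in the noncommutative `K[G]`. Requiring those of the entries to be central lets
the determinants with a replaced column be computed in the commutative center. -/
theorem hasWeight_det {ι : Type*} [Fintype ι] [DecidableEq ι] {r : ℤ}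
    {A B : Matrix ι ι (Subalgebra.center K (KG K m n))} (hA : ∀ i j, A i j ∈ evenCenter K m n)
    (hB : ∀ i j, d ⟨A i j, hA i j⟩ = B i j)
    (hr : ∑ j, (A.updateCol j fun i => B i j).det = r • A.det) : HasWeight d r A.det := by
  have h := d.map_det (centerVal K m n)
    (Matrix.of fun i j => (⟨A i j, hA i j⟩ : evenCenter K m n)) B hB
  have e := coe_det_evenCenter hA
  refine ⟨e ▸ Subtype.property _, ?_⟩
  have e' : (⟨A.det, e ▸ Subtype.property _⟩ : evenCenter K m n) =
      (Matrix.of fun i j => (⟨A i j, hA i j⟩ : evenCenter K m n)).det := Subtype.ext e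
  rw [e', h]
  change centerVal K m n (∑ j, (A.updateCol j fun i => B i j).det) = _
  rw [hr, map_zsmul]
  rfl

theorem hasWeight_det_zero {ι : Type*} [Fintype ι] [DecidableEq ι]
    {A : Matrix ι ι (Subalgebra.center K (KG K m n))}
    (hA : ∀ i j, HasWeight d 0 (A i j)) : HasWeight d 0 A.det := by
  refine hasWeight_det (B := 0) (fun i j => (hA i j).1) (fun i j => ?_) ?_
  · rw [(hA i j).2, zero_smul]
    rfl
  · rw [zero_smul]
    exact Finset.sum_eq_zero fun j _ => Matrix.det_eq_zero_of_column_eq_zero j fun i => by simp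

/-- A derivation that replaces the `k`-th column of `C` by a preceding column multiplies the
leading minors by an integer. -/
theorem hasWeight_leading_minor {N s : ℕ} (hs : s ≤ N)
    {C : Matrix (Fin N) (Fin N) (Subalgebra.center K (KG K m n))} {k a : Fin N} (hak : a ≤ k)
    (hC : ∀ i j, C i j ∈ evenCenter K m n)
    (hd : ∀ i j, d ⟨C i j, hC i j⟩ = if j = k then (C i a : KG K m n) else 0) :
    HasWeight d (if (k : ℕ) < s then if a = k then 1 else 0 else 0)
      (C.submatrix (Fin.castLE hs) (Fin.castLE hs)).det := by
  refine hasWeight_det (B := Matrix.of fun i j => if Fin.castLE hs j = k then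
    C (Fin.castLE hs i) a else 0) (fun i j => hC _ _) (fun i j => ?_) ?_
  · refine (hd _ _).trans ?_
    rw [Matrix.of_apply]
    split_ifs <;> rfl
  -- A column other than the `k`-th has derivative zero.
  · have hz : ∀ j : Fin s, Fin.castLE hs j ≠ k →
        ((C.submatrix (Fin.castLE hs) (Fin.castLE hs)).updateCol j fun i =>
          (Matrix.of fun i j : Fin s => if Fin.castLE hs j = k then
            C (Fin.castLE hs i) a else 0) i j).det = 0 := by
      intro j hj
      exact Matrix.det_eq_zero_of_column_eq_zero j fun i => by simp [hj]
    by_cases hk : (k : ℕ) < s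
    · have hk' : Fin.castLE hs ⟨k, hk⟩ = k := rfl
      rw [Finset.sum_eq_single ⟨k, hk⟩ (fun j _ hj => hz j fun h => hj (Fin.castLE_injective hs
        (h.trans hk'.symm))) (by simp), if_pos hk]
      by_cases ha : a = k
      · rw [if_pos ha, one_smul]
        congr 1
        ext i j : 2
        by_cases hj : j = ⟨k, hk⟩
        · subst hj; simp [ha, hk']
        · rw [Matrix.updateCol_ne hj]
      · rw [if_neg ha, zero_smul]
        -- Since `a ≤ k`, column `a` also belongs to the minor, so it now occurs twice.
        have hlt : (a : ℕ) < s := lt_of_le_of_lt hak hk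
        have hne : (⟨a, hlt⟩ : Fin s) ≠ ⟨k, hk⟩ := fun h => ha (Fin.ext (Fin.mk.inj h))
        refine Matrix.det_zero_of_column_eq hne fun i => ?_
        rw [Matrix.updateCol_ne hne, Matrix.updateCol_self]
        simp [hk']
    · rw [if_neg hk, zero_smul]
      exact Finset.sum_eq_zero fun j _ => hz j fun h => hk (by rw [← h]; exact j.2)

theorem hasWeight_w {r : ℤ} {p q : ℕ → ℤ} (lp : Fin m → ℤ) (lm : Fin n → ℕ)
    (I : Fin m → ℕ → Fin m) (J : Fin n → ℕ → Fin n) (hD : HasWeight d r (C11 K m n).det)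
    (hp : ∀ b, HasWeight d (p b) (Dplus K n (colLen_le (shape lp) b)
      fun a => I (Fin.castLE (colLen_le (shape lp) b) a) b))
    (hq : ∀ b, HasWeight d (q b) (Dminus K m (colLen_le lm b)
      fun a => J (Fin.castLE (colLen_le lm b) a) b)) :
    HasWeight d (twist lp * r + ∑ b ∈ Finset.range (Finset.univ.sup (shape lp)), p b +
        ∑ b ∈ Finset.range (Finset.univ.sup lm), q b)
      (wplus K n lp I * Bminus K m lm J) :=
  ((HasWeight.zpow (u := detUnit K m n) hD _).mul (HasWeight.prod _ fun b _ => hp b)).mul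
    (HasWeight.prod _ fun b _ => hq b)

/-- Weight zero means annihilation by `d`, so it is enough to test the entries of the two blocks;
the tableaux play no role. -/
theorem hasWeight_zero_w
    (hC : ∀ i j, HasWeight d 0 (C11 K m n i j))
    (hP : ∀ i j, HasWeight d 0 ⟨phi K i j, phi_mem_center K i j⟩) (lp : Fin m → ℤ)
    (lm : Fin n → ℕ) (I : Fin m → ℕ → Fin m) (J : Fin n → ℕ → Fin n) :
    HasWeight d 0 (wplus K n lp I * Bminus K m lm J) := by
  simpa using hasWeight_w (p := fun _ => 0) (q := fun _ => 0) lp lm I J (hasWeight_det_zero hC)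
    (fun b => hasWeight_det_zero fun _ _ => hC _ _) (fun b => hasWeight_det_zero fun _ _ => hP _ _)

theorem C11_mem_evenCenter (i j : Fin m) : C11 K m n i j ∈ evenCenter K m n :=
  mem_evenCenter.2 fun p => tw_c_ll p i j

theorem phi_mem_evenCenter (i j : Fin n) :
    (⟨phi K i j, phi_mem_center K i j⟩ : Subalgebra.center K (KG K m n)) ∈ evenCenter K m n :=
  mem_evenCenter.2 fun p => tw_phi p i j

/-! ### The odd superderivations on `w`. -/

theorem sderiv_lr_w (lp : Fin m → ℤ) (lm : Fin n → ℕ) (I : Fin m → ℕ → Fin m)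
    (J : Fin n → ℕ → Fin n) (k : Fin m) (l : Fin n) :
    sderiv (Sum.inl k) (Sum.inr l) (w K lp lm I J) =
      ∑ a, sderiv (Sum.inl k) (Sum.inl a) (w K lp lm I J) * y K a l +
        ∑ b, sderiv (Sum.inr b) (Sum.inr l) (w K lp lm I J) * y K k b := by
  have h : HasWeight (defect k l) 0 (wplus K n lp I * Bminus K m lm J) := by
    refine hasWeight_zero_w (fun i j => ⟨C11_mem_evenCenter i j, ?_⟩)
      (fun i j => ⟨phi_mem_evenCenter i j, ?_⟩) lp lm I J
    · rw [defect_apply]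
      change sderiv _ _ (c K (Sum.inl i) (Sum.inl j)) -
        (∑ s, sderiv _ _ (c K (Sum.inl i) (Sum.inl j)) * _ +
          ∑ b, sderiv _ _ (c K (Sum.inl i) (Sum.inl j)) * _) = _
      -- For `j = k` this is `c_{il} = ∑ c_{is} y_{sl}`; the sum over `b` vanishes because `j` is an
      -- even index.
      by_cases hj : j = k <;> simp [sderiv_c, hj, sum_c_mul_y]
    · rw [defect_apply]
      change sderiv _ _ (phi K i j) - (∑ s, sderiv _ _ (phi K i j) * _ +
          ∑ b, sderiv _ _ (phi K i j) * _) = _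
      -- Only the term `b = j` survives, and it equals `φ_{il} y_{kj}`.
      simp [sderiv_phi_lr, sderiv_phi_ll, sderiv_phi_rr]
  obtain ⟨h, h'⟩ := h
  rw [defect_apply, zero_smul] at h'
  exact sub_eq_zero.1 h'

theorem sderiv_rl_w (lp : Fin m → ℤ) (lm : Fin n → ℕ) (I : Fin m → ℕ → Fin m)
    (J : Fin n → ℕ → Fin n) (k : Fin m) (l : Fin n) :
    sderiv (Sum.inr l) (Sum.inl k) (w K lp lm I J) = 0 := by
  have h : HasWeight (evenDeriv (Sum.inr l) (Sum.inl k)) 0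
      (wplus K n lp I * Bminus K m lm J) := by
    refine hasWeight_zero_w (fun i j => ⟨C11_mem_evenCenter i j, ?_⟩)
      (fun i j => ⟨phi_mem_evenCenter i j, ?_⟩) lp lm I J
    · refine (sderiv_c _ _ _ _).trans ?_
      simp
    · refine (sderiv_phi_rl _ _ _ _).trans ?_
      simp
  obtain ⟨h, h'⟩ := h
  rw [zero_smul] at h'
  exact h'

/-! ### The highest vector as a weight vector. -/

/-- Only `v⁺` contributes, since `_{ka}D` kills every `φ`. For `a = k`, the power of `D` contributes
`twist lp` and the columns of the tableau contribute `shape lp k`. -/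
theorem sderiv_ll_v (lp : Fin m → ℤ) (hlp : Antitone lp) (lm : Fin n → ℕ) {k a : Fin m}
    (hak : a ≤ k) :
    sderiv (Sum.inl k) (Sum.inl a) (v K lp lm) = (if a = k then lp k else 0) • v K lp lm := by
  have hminor : ∀ (s : ℕ) (hs : s ≤ m), HasWeight (evenDeriv (Sum.inl k) (Sum.inl a))
      (if (k : ℕ) < s then if a = k then 1 else 0 else 0)
      ((C11 K m n).submatrix (Fin.castLE hs) (Fin.castLE hs)).det := by
    intro s hs
    refine hasWeight_leading_minor hs hak C11_mem_evenCenter fun i j => ?_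
    refine (sderiv_c _ _ _ _).trans ?_
    simp only [Sum.inl.injEq]
    rfl
  obtain ⟨_, h⟩ := hasWeight_w (q := fun _ => 0) lp lm (fun a _ => a) (fun a _ => a)
    -- `D` itself is the leading minor of size `m`, and it always contains column `k`.
    (hminor m le_rfl) (fun b => hminor _ (colLen_le (shape lp) b))
    (fun b => hasWeight_det_zero fun i j => ⟨phi_mem_evenCenter _ _, by
      rw [zero_smul]; exact sderiv_phi_ll _ _ _ _⟩)
  refine h.trans ?_
  change _ • v K lp lm = _
  congr 1
  rw [if_pos k.2, Finset.sum_const_zero, add_zero]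
  by_cases ha : a = k
  · simp only [if_pos ha]
    rw [sum_range_lt_colLen _ (antitone_shape lp hlp), mul_one, twist_add_shape lp hlp]
  · simp [if_neg ha]

/-- Here `v⁺` is killed, as `_{bl}D` acts on columns with odd index; on `φ` it replaces column `b`
by column `l`. -/
theorem sderiv_rr_v (lp : Fin m → ℤ) (lm : Fin n → ℕ) (hlm : Antitone lm) {b l : Fin n}
    (hlb : l ≤ b) :
    sderiv (Sum.inr b) (Sum.inr l) (v K lp lm) = (if l = b then (lm b : ℤ) else 0) • v K lp lm := by
  have hC : ∀ i j, HasWeight (evenDeriv (Sum.inr b) (Sum.inr l)) 0 (C11 K m n i j) := fun i j =>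
    ⟨C11_mem_evenCenter i j, by
      refine (sderiv_c _ _ _ _).trans ?_
      simp⟩
  obtain ⟨_, h⟩ := hasWeight_w (p := fun _ => 0) lp lm (fun a _ => a) (fun a _ => a)
    (hasWeight_det_zero hC) (fun b => hasWeight_det_zero fun i j => hC _ _)
    (fun c => hasWeight_leading_minor (colLen_le lm c) hlb
      (C := Matrix.of fun i j => ⟨phi K i j, phi_mem_center K i j⟩) phi_mem_evenCenter
      fun i j => sderiv_phi_rr _ _ _ _)
  refine h.trans ?_
  change _ • v K lp lm = _
  congr 1
  rw [Finset.sum_const_zero, mul_zero, zero_add, zero_add]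
  by_cases hl : l = b
  · simp only [if_pos hl]
    exact sum_range_lt_colLen _ hlm b
  · simp [if_neg hl]

/-- Terms with `a < k` vanish and `a = k` gives the weight. -/
theorem sum_ll_v (lp : Fin m → ℤ) (hlp : Antitone lp) (lm : Fin n → ℕ) (k : Fin m) (l : Fin n) :
    ∑ a, sderiv (Sum.inl k) (Sum.inl a) (v K lp lm) * y K a l =
      lp k • (v K lp lm * y K k l) + ∑ s ∈ Finset.univ.filter (fun s : Fin m => k < s),
        sderiv (Sum.inl k) (Sum.inl s) (v K lp lm) * y K s l := by
  rw [← Finset.sum_filter_not_add_sum_filter Finset.univ (fun s => k < s)]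
  congr 1
  rw [Finset.sum_eq_single_of_mem k (by simp)]
  · rw [sderiv_ll_v lp hlp lm le_rfl, if_pos rfl, smul_mul_assoc]
  · intro a ha hak
    rw [sderiv_ll_v lp hlp lm (not_lt.1 (Finset.mem_filter.1 ha).2), if_neg hak, zero_smul,
      zero_mul]

theorem sum_rr_v (lp : Fin m → ℤ) (lm : Fin n → ℕ) (hlm : Antitone lm) (k : Fin m) (l : Fin n) :
    ∑ b, sderiv (Sum.inr b) (Sum.inr l) (v K lp lm) * y K k b =
      (lm l : ℤ) • (v K lp lm * y K k l) + ∑ t ∈ Finset.univ.filter (fun t : Fin n => t < l),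
        sderiv (Sum.inr t) (Sum.inr l) (v K lp lm) * y K k t := by
  rw [← Finset.sum_filter_not_add_sum_filter Finset.univ (fun t => t < l)]
  congr 1
  rw [Finset.sum_eq_single_of_mem l (by simp)]
  · rw [sderiv_rr_v lp lm hlm le_rfl, if_pos rfl, smul_mul_assoc]
  · intro b hb hbl
    rw [sderiv_rr_v lp lm hlm (not_lt.1 (Finset.mem_filter.1 hb).2), if_neg hbl.symm, zero_smul,
      zero_mul]

end SuperGL

end

theorem theorem2 {K : Type*} [Field K] (hK : ringChar K ≠ 2) (m n : ℕ)
    (lp : Fin m → ℤ) (hlp : Antitone lp) (lm : Fin n → ℕ) (hlm : Antitone lm)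
    (k : Fin m) (l : Fin n) :
    (∀ (I : Fin m → ℕ → Fin m) (J : Fin n → ℕ → Fin n),
      SuperGL.sderiv (Sum.inl k) (Sum.inr l) (SuperGL.w K lp lm I J) =
          ∑ a : Fin m, SuperGL.sderiv (Sum.inl k) (Sum.inl a) (SuperGL.w K lp lm I J) *
            SuperGL.y K a l +
          ∑ b : Fin n, SuperGL.sderiv (Sum.inr b) (Sum.inr l) (SuperGL.w K lp lm I J) *
            SuperGL.y K k b ∧
        SuperGL.sderiv (Sum.inr l) (Sum.inl k) (SuperGL.w K lp lm I J) = 0) ∧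
    (SuperGL.sderiv (Sum.inl k) (Sum.inr l) (SuperGL.v K lp lm) =
        ((lp k + (lm l : ℤ) : ℤ) : K) • (SuperGL.v K lp lm * SuperGL.y K k l) +
        ∑ s ∈ Finset.univ.filter (fun s : Fin m => k < s),
          SuperGL.sderiv (Sum.inl k) (Sum.inl s) (SuperGL.v K lp lm) * SuperGL.y K s l +
        ∑ t ∈ Finset.univ.filter (fun t : Fin n => t < l),
          SuperGL.sderiv (Sum.inr t) (Sum.inr l) (SuperGL.v K lp lm) * SuperGL.y K k t ∧
      SuperGL.sderiv (Sum.inr l) (Sum.inl k) (SuperGL.v K lp lm) = 0) := by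
  refine ⟨fun I J => ⟨SuperGL.sderiv_lr_w lp lm I J k l, SuperGL.sderiv_rl_w lp lm I J k l⟩,
    ?_, SuperGL.sderiv_rl_w lp lm _ _ k l⟩
  refine (SuperGL.sderiv_lr_w lp lm _ _ k l).trans ?_
  refine (congrArg₂ (· + ·) (SuperGL.sum_ll_v lp hlp lm k l)
    (SuperGL.sum_rr_v lp lm hlm k l)).trans ?_
  rw [Int.cast_smul_eq_zsmul, add_smul]
  abel
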